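/- **Setting.** Let $(\mu_\alpha)$ be a net of Radon (equivalently, Borel) sub-probability measures on $X=\mathbb{R}$ and $(t_\alpha)$ a net in $]0,+\infty[$, over the same directed set, converging to $0$. Write $\mu_\alpha^{t_\alpha}(A)=(\mu_\alpha(A))^{t_\alpha}$ for Borel $A\subset\mathbb{R}$. Let $\mathcal{C}(X)$ be the set of continuous functions $h:\mathbb{R}\to[-\infty,+\infty[$. For $h\in\mathcal{C}(X)$ put $$\underline{\Lambda}(h)=\log\liminf_\alpha\Big(\int e^{h/t_\alpha}d\mu_\alpha\Big)^{t_\alpha},\qquad \overline{\Lambda}(h)=\log\limsup_\alpha\Big(\int e^{h/t_\alpha}d\mu_\alpha\Big)^{t_\alpha},$$ and say that $\Lambda(h)$ exists (in $[-\infty,+\infty]$) if these are equal, $\Lambda(h)$ being the common value. For $\lambda\in\mathbb{R}$ let $h_\lambda(x)=\lambda x$ and $L(\lambda)=\Lambda(h_\lambda)$ when it exists. For $x\in\mathbb{R}$ put $$l_0(x)=-\log\inf\{\limsup_\alpha\mu_\alpha^{t_\alpha}(U):U\ni x\text{ open}\},\qquad l_1(x)=-\log\inf\{\liminf_\alpha\mu_\alpha^{t_\alpha}(U):U\ni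 x\text{ open}\}.$$ For $f:\mathbb{R}\to[-\infty,+\infty]$ let $\mathrm{Dom}(f)=\{f<+\infty\}$, and let $\mathrm{int}\,\mathrm{Dom}(f)$ be its interior. A vague large deviation principle (LDP) with powers $(t_\alpha)$ and rate function $J$ holds if $J:\mathbb{R}\to[0,+\infty]$ is lower semicontinuous, $\limsup_\alpha\mu_\alpha^{t_\alpha}(K)\le\sup_{x\in K}e^{-J(x)}$ for all compact $K$, and $\sup_{x\in U}e^{-J(x)}\le\liminf_\alpha\mu_\alpha^{t_\alpha}(U)$ for all open $U$; it is narrow if the first bound holds for all closed sets $K$. A convex function on $\mathbb{R}$ is proper if it never takes the value $-\infty$ and is finite at some point. **Theorem.** Let $\mathcal{S}\subset\mathcal{C}(X)$ and let $G\subset\mathbb{R}$ be a nonempty open interval with $\{h_\lambda:\lambda\in G\}\subset\mathcal{S}$. Assume that $\Lambda(h)$ exists for all $h\in\mathcal{S}$ and that $L(\lambda)$ is finite for all $\lambda\in G$. Put $$\Lambda_{|\mathcal S}^*(x)=\sup_{h\in\mathcal{S}}\{h(x)-\Lambda(h)\},\qquad L_{|G}^*(x)=\sup_{\lambda\in G}\{\lambda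 x-L(\lambda)\}$$ (undefined differences $(-\infty)-(-\infty)$ being read as $-\infty$), and let $R=\mathrm{ran}\,L_{|G}'{}_-\cup\mathrm{ran}\,L_{|G}'{}_+$ be the union of the ranges of the left and right derivatives of $L_{|G}$. (a) If $R\supset\mathrm{Dom}(l_0)\cap\{l_1>-\overline{\Lambda}(0)\}$, then a vague LDP with powers $(t_\alpha)$ holds, with a rate function $J$ such that $J=L_{|G}^*=\Lambda_{|\mathcal S}^*$ on $\mathrm{Dom}(J)\cap\{J>-\overline{\Lambda}(0)\}$. If moreover $0\in G$, the principle is narrow and $J=L_{|G}^*=\Lambda_{|\mathcal S}^*$ on $\mathrm{Dom}(J)$. (b) If $R\supset\mathrm{Dom}(l_0)$, then a vague LDP with powers $(t_\alpha)$ holds, with a rate function $J$ such that $J=L_{|G}^*=\Lambda_{|\mathcal S}^*$ on $\mathrm{Dom}(J)$. If moreover $0\in G$, the principle is narrow. (c) If $R\supset\mathrm{Dom}(\Lambda_{|\mathcal S}^*)\cap\{l_1>-\overline{\Lambda}(0)\}$, then a vague LDP with powers $(t_\alpha)$ holds, with a rate function $J$ such that $J=\Lambda_{|\mathcal S}^*$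 on $\{J>-\overline{\Lambda}(0)\}$ and $J=L_{|G}^*$ on $\mathrm{Dom}(\Lambda_{|\mathcal S}^*)\cap\{J>-\overline{\Lambda}(0)\}$. If moreover $0\in G$, the principle is narrow, $J=\Lambda_{|\mathcal S}^*$ everywhere, and $J=L_{|G}^*$ on $\mathrm{Dom}(J)$. (d) If $R\supset\mathrm{Dom}(\Lambda_{|\mathcal S}^*)$, then a vague LDP with powers $(t_\alpha)$ holds with rate function $J=\Lambda_{|\mathcal S}^*$, and $J=L_{|G}^*$ on $\mathrm{Dom}(J)$. If moreover $0\in G$, the principle is narrow. (e) If $l_0$ is proper convex, then (a) and (b) each remain true with $\mathrm{Dom}$ replaced by $\mathrm{int}\,\mathrm{Dom}$ everywhere, in the hypothesis and in the conclusions. (f) If $\Lambda_{|\mathcal S}^*$ is proper convex and lower semicontinuous, then (c) and (d) each remain true with $\mathrm{Dom}$ replaced by $\mathrm{int}\,\mathrm{Dom}$ everywhere, in the hypothesis and in the conclusions. -/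

import Mathlib

open Filter Topology MeasureTheory
open scoped ENNReal

noncomputable section

namespace NetLDP

variable {ι : Type*} [Preorder ι]

/-- `μ_α^{t_α}(A) = (μ_α(A))^{t_α}`. -/
def powMeas (μ : ι → Measure ℝ) (t : ι → ℝ) (A : Set ℝ) (α : ι) : ℝ≥0∞ :=
  (μ α A) ^ (t α)

/-- `μ_α^{t_α}(e^{h/t_α}) = (∫ e^{h(x)/t_α} μ_α(dx))^{t_α}` for `h` with extended real values
(and `e^{-∞} = 0`). -/
def powInt (μ : ι → Measure ℝ) (t : ι → ℝ) (h : ℝ → EReal) (α : ι) : ℝ≥0∞ :=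
  (∫⁻ x, EReal.exp (h x / ((t α : ℝ) : EReal)) ∂(μ α)) ^ (t α)

/-- The lower functional `log liminf μ_α^{t_α}(e^{h/t_α})`. -/
def lamLower (μ : ι → Measure ℝ) (t : ι → ℝ) (h : ℝ → EReal) : EReal :=
  ENNReal.log (liminf (powInt μ t h) atTop)

/-- The upper functional `log limsup μ_α^{t_α}(e^{h/t_α})`. -/
def lamUpper (μ : ι → Measure ℝ) (t : ι → ℝ) (h : ℝ → EReal) : EReal :=
  ENNReal.log (limsup (powInt μ t h) atTop)

/-- `Λ(h)` exists (as an extended real number): the lower and upper functionals agree at `h`. -/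
def LamExists (μ : ι → Measure ℝ) (t : ι → ℝ) (h : ℝ → EReal) : Prop :=
  lamLower μ t h = lamUpper μ t h

/-- The value `Λ(h)`; it is only meaningful when `LamExists μ t h` holds, and it is then the
common value of the lower and upper functionals. -/
def lam (μ : ι → Measure ℝ) (t : ι → ℝ) (h : ℝ → EReal) : EReal :=
  lamUpper μ t h

/-- The linear function `h_l(x) = l x`. -/
def lin (l : ℝ) : ℝ → EReal := fun x => ((l * x : ℝ) : EReal)

/-- The generalized log-moment generating function `L(l) = Λ(h_l)`. -/
def logMGF (μ : ι → Measure ℝ) (t : ι → ℝ) (l : ℝ) : EReal :=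
  lam μ t (lin l)

/-- `l_0(x) = - log inf {limsup μ_α^{t_α}(U) : U open, x ∈ U}`. -/
def rateZero (μ : ι → Measure ℝ) (t : ι → ℝ) (x : ℝ) : EReal :=
  -ENNReal.log (⨅ (U : Set ℝ) (_ : IsOpen U ∧ x ∈ U), limsup (powMeas μ t U) atTop)

/-- `l_1(x) = - log inf {liminf μ_α^{t_α}(U) : U open, x ∈ U}`. -/
def rateOne (μ : ι → Measure ℝ) (t : ι → ℝ) (x : ℝ) : EReal :=
  -ENNReal.log (⨅ (U : Set ℝ) (_ : IsOpen U ∧ x ∈ U), liminf (powMeas μ t U) atTop)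

/-- Vague large deviation principle with powers `t` and rate function `J`: the upper bound is
required for compact sets. -/
structure IsVagueLDP (μ : ι → Measure ℝ) (t : ι → ℝ) (J : ℝ → EReal) : Prop where
  nonneg : ∀ x, 0 ≤ J x
  lsc : LowerSemicontinuous J
  upper : ∀ K : Set ℝ, IsCompact K →
    limsup (powMeas μ t K) atTop ≤ ⨆ x ∈ K, EReal.exp (-J x)
  lower : ∀ U : Set ℝ, IsOpen U →
    ⨆ x ∈ U, EReal.exp (-J x) ≤ liminf (powMeas μ t U) atTop

/-- (Narrow) large deviation principle with powers `t` and rate function `J`: the upper bound is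
required for closed sets. -/
structure IsNarrowLDP (μ : ι → Measure ℝ) (t : ι → ℝ) (J : ℝ → EReal) : Prop where
  nonneg : ∀ x, 0 ≤ J x
  lsc : LowerSemicontinuous J
  upper : ∀ F : Set ℝ, IsClosed F →
    limsup (powMeas μ t F) atTop ≤ ⨆ x ∈ F, EReal.exp (-J x)
  lower : ∀ U : Set ℝ, IsOpen U →
    ⨆ x ∈ U, EReal.exp (-J x) ≤ liminf (powMeas μ t U) atTop

/-- The abstract Legendre-Fenchel transform `x ↦ sup_{h ∈ S} (h(x) - Λ(h))` of `Λ` restricted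
to `S`. In `EReal` one has `⊥ - ⊥ = ⊥`, so that an undefined difference `(-∞) - (-∞)` does not
contribute to the supremum. -/
def absLegendre (μ : ι → Measure ℝ) (t : ι → ℝ) (S : Set (ℝ → EReal)) (x : ℝ) : EReal :=
  ⨆ h ∈ S, (h x - lam μ t h)

/-- The Legendre-Fenchel transform of an extended real valued function on `ℝ`. -/
def legendre (f : ℝ → EReal) (x : ℝ) : EReal :=
  ⨆ l : ℝ, (((l * x : ℝ) : EReal) - f l)

open Classical in
/-- The function equal to `f` on `G` and to `+∞` outside `G`. -/
def extendTop (G : Set ℝ) (f : ℝ → EReal) (l : ℝ) : EReal :=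
  if l ∈ G then f l else ⊤

/-- The Legendre-Fenchel transform of the restriction of `L` to `G`. -/
def logMGFStar (μ : ι → Measure ℝ) (t : ι → ℝ) (G : Set ℝ) : ℝ → EReal :=
  legendre (extendTop G (logMGF μ t))

/-- The union of the ranges of the left and of the right derivative of a function `f` restricted
to `G`, where `f` is assumed finite on `G`. -/
def ranSided (f : ℝ → EReal) (G : Set ℝ) : Set ℝ :=
  {x | ∃ l ∈ G, HasDerivWithinAt (fun s => (f s).toReal) x (G ∩ Set.Iio l) l} ∪
  {x | ∃ l ∈ G, HasDerivWithinAt (fun s => (f s).toReal) x (G ∩ Set.Ioi l) l}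

/-- The effective domain `{f < +∞}`. -/
def Dom (f : ℝ → EReal) : Set ℝ := {x | f x < ⊤}

/-- Proper convex function on `ℝ`: the epigraph is convex, the value `-∞` is not taken, and some
value is finite. -/
def IsProperConvex (f : ℝ → EReal) : Prop :=
  Convex ℝ {p : ℝ × ℝ | f p.1 ≤ (p.2 : EReal)} ∧ (∀ x, f x ≠ ⊥) ∧ ∃ x, f x ≠ ⊤

end NetLDP

end

open NetLDP

/-!
The functions `rateZero` and `rateOne` always give the two halves of a vague large deviation
principle: covering a compact set by small open sets gives the upper bound with `rateZero`
(`limsup_powMeas_le_of_isCompact`; only the maximum of finitely many terms survives, as `t → 0`),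
and the lower bound with `rateOne` is immediate. Since `rateZero ≤ rateOne`, everything comes down
to `rateOne ≤ rateZero`, and the rate function is then this common function
(`isVagueLDP_of_rateOne_le`). Two lower bounds for `rateZero` are free: the trivial one
`-Λ̄(0) ≤ rateZero`, and `L*_G ≤ Λ*_S ≤ rateZero`, the lower half of Varadhan's lemma
(`sub_lamUpper_le_rateZero`). So it is enough to bound `rateOne x` from above by `-Λ̄(0)` or by
one of these transforms.

The crux is `rateOne_le_logMGFStar_of_mem_ranSided`: if `x` is a one-sided derivative of `L` at
`l ∈ G`, then `rateOne x ≤ l x - L(l)`. Say it is the right derivative. For small `η > 0` the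
difference quotients of `L` over `[l, l + η]` and over `[l + η, l + 2η]` are both close to `x`. By
Chernoff's bound with exponents `l` and `l + 2η`, the integral of `e^{(l + η) z / t}` over
`|z - x| ≥ ε` is negligible compared with the full integral, so that the interval
`|z - x| < ε` carries at least `e^{L(l + η) - (l + η) x - o(1)}`. Then `η` and `ε` tend to `0`.
Neither differentiability nor convexity of `L` is used.

When only the interior of the domain of a convex function `f` is controlled (`f = rateZero` or
`f = Λ*_S`), the bound extends to boundary points along segments, because `rateOne` is lower
semicontinuous (`IsProperConvex.le_max_of_forall_interior`). If the domain has empty interior, then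
`rateZero` is infinite off a single point, all tilted integrals concentrate there, and the bound
holds without further hypotheses (`rateOne_le_logMGFStar_of_forall_ne`). When `0 ∈ G`, exponential
tightness makes the principle narrow, and `-Λ̄(0) = -L(0) ≤ L*_G` removes the exception
made for points where the rate is at most `-Λ̄(0)`.
-/

namespace NetLDP

/-! ### Powers with vanishing exponents -/

section Powers

variable {ι : Type*} {F : Filter ι} {t : ι → ℝ}

/-- A common bound for two powers is asymptotically a bound for the power of the sum, uniformly
in the bases: this form serves upper and lower limits alike. -/
theorem eventually_add_rpow_lt (ht : ∀ α, 0 < t α) (ht0 : Tendsto t F (𝓝 0)) {c d : ℝ≥0∞}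
    (hcd : c < d) :
    ∀ᶠ α in F, ∀ a b : ℝ≥0∞, a ^ t α ≤ c → b ^ t α ≤ c → (a + b) ^ t α < d := by
  have h2 : Tendsto (fun α => (2 : ℝ≥0∞) ^ t α) F (𝓝 1) := by
    have h := ENNReal.tendsto_ofReal
      (((Real.continuous_const_rpow (two_ne_zero (α := ℝ))).tendsto 0).comp ht0)
    simp only [Real.rpow_zero, ENNReal.ofReal_one] at h
    refine h.congr fun α => ?_
    simp [← ENNReal.ofReal_rpow_of_pos]
  have h3 : Tendsto (fun α => (2 : ℝ≥0∞) ^ t α * c) F (𝓝 c) := by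
    simpa using ENNReal.Tendsto.mul_const h2 (Or.inl one_ne_zero)
  filter_upwards [h3.eventually_lt_const hcd] with α hα a b ha hb
  refine lt_of_le_of_lt ?_ hα
  calc (a + b) ^ t α ≤ (2 * max a b) ^ t α := by
        refine ENNReal.rpow_le_rpow ?_ (ht α).le
        rw [two_mul]
        exact add_le_add (le_max_left _ _) (le_max_right _ _)
    _ = 2 ^ t α * max a b ^ t α := ENNReal.mul_rpow_of_nonneg _ _ (ht α).le
    _ ≤ 2 ^ t α * c := by
        gcongr
        rcases max_choice a b with h | h <;> rw [h] <;> assumption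

/-- Since `t → 0`, the factor `2 ^ t` lost in `a + b ≤ 2 max a b` disappears in the limit. -/
theorem limsup_add_rpow_le (ht : ∀ α, 0 < t α) (ht0 : Tendsto t F (𝓝 0)) (a b : ι → ℝ≥0∞) :
    limsup (fun α => (a α + b α) ^ t α) F ≤
      max (limsup (fun α => a α ^ t α) F) (limsup (fun α => b α ^ t α) F) := by
  refine le_of_forall_gt_imp_ge_of_dense fun d hd => ?_
  obtain ⟨c, hc, hcd⟩ := exists_between hd
  refine limsup_le_of_le (by isBoundedDefault) ?_
  filter_upwards [eventually_add_rpow_lt ht ht0 hcd,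
    eventually_lt_of_limsup_lt ((le_max_left _ _).trans_lt hc),
    eventually_lt_of_limsup_lt ((le_max_right _ _).trans_lt hc)] with α h ha hb
  exact (h _ _ ha.le hb.le).le

theorem liminf_add_rpow_le (ht : ∀ α, 0 < t α) (ht0 : Tendsto t F (𝓝 0)) (a b : ι → ℝ≥0∞) :
    liminf (fun α => (a α + b α) ^ t α) F ≤
      max (liminf (fun α => a α ^ t α) F) (limsup (fun α => b α ^ t α) F) := by
  refine le_of_forall_gt_imp_ge_of_dense fun d hd => ?_
  obtain ⟨c, hc, hcd⟩ := exists_between hd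
  refine liminf_le_of_frequently_le' ?_
  have ha : ∃ᶠ α in F, a α ^ t α < c :=
    frequently_lt_of_liminf_lt (by isBoundedDefault) ((le_max_left _ _).trans_lt hc)
  refine (ha.and_eventually ((eventually_add_rpow_lt ht ht0 hcd).and
    (eventually_lt_of_limsup_lt ((le_max_right _ _).trans_lt hc)))).mono ?_
  rintro α ⟨ha, h, hb⟩
  exact (h _ _ ha.le hb.le).le

theorem limsup_const_mul_eq [F.NeBot] (b : ℝ) (u : ι → ℝ≥0∞) :
    limsup (fun α => EReal.exp b * u α) F = EReal.exp b * limsup u F :=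
  (Monotone.map_limsup_of_continuousAt (f := fun y => EReal.exp b * y)
    (fun _ _ h => mul_le_mul_right h _) u
    (ENNReal.continuous_const_mul (by simp)).continuousAt).symm

theorem liminf_const_mul_eq [F.NeBot] (b : ℝ) (u : ι → ℝ≥0∞) :
    liminf (fun α => EReal.exp b * u α) F = EReal.exp b * liminf u F :=
  (Monotone.map_liminf_of_continuousAt (f := fun y => EReal.exp b * y)
    (fun _ _ h => mul_le_mul_right h _) u
    (ENNReal.continuous_const_mul (by simp)).continuousAt).symm

end Powers

/-! ### Exponential integrals over sets -/

section Integrals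

variable {ι : Type*} {μ : ι → Measure ℝ} {t : ι → ℝ}

/-- The part of `powInt` carried by a set: `(∫_A e^{h(x)/t_α} μ_α(dx))^{t_α}`. For `h = 0` it is
`powMeas`, and for `A = univ` it is `powInt`. -/
noncomputable def setPowInt (μ : ι → Measure ℝ) (t : ι → ℝ) (h : ℝ → EReal) (A : Set ℝ) (α : ι) :
    ℝ≥0∞ :=
  (∫⁻ x in A, EReal.exp (h x / ((t α : ℝ) : EReal)) ∂(μ α)) ^ (t α)

theorem setPowInt_zero (A : Set ℝ) : setPowInt μ t 0 A = powMeas μ t A := by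
  ext α
  simp [setPowInt, powMeas]

theorem setPowInt_univ (h : ℝ → EReal) : setPowInt μ t h Set.univ = powInt μ t h := by
  ext α
  simp [setPowInt, powInt]

theorem powInt_zero : powInt μ t 0 = powMeas μ t Set.univ := by
  rw [← setPowInt_univ, setPowInt_zero]

theorem lin_zero : lin 0 = 0 := by
  ext x
  simp [lin]

theorem setPowInt_mono (ht : ∀ α, 0 < t α) (h : ℝ → EReal) {A B : Set ℝ} (hAB : A ⊆ B) (α : ι) :
    setPowInt μ t h A α ≤ setPowInt μ t h B α :=
  ENNReal.rpow_le_rpow (lintegral_mono_set hAB) (ht α).le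

theorem powMeas_mono (ht : ∀ α, 0 < t α) {A B : Set ℝ} (hAB : A ⊆ B) (α : ι) :
    powMeas μ t A α ≤ powMeas μ t B α :=
  ENNReal.rpow_le_rpow (measure_mono hAB) (ht α).le

/-- The change of exponent behind every exponential estimate here: a bound `h ≤ b + g` on `A`
becomes a factor `e^b` that no longer depends on the index. -/
theorem setPowInt_le_exp_mul (ht : ∀ α, 0 < t α) {g h : ℝ → EReal} {A : Set ℝ}
    (hA : MeasurableSet A) {b : ℝ} (hb : ∀ z ∈ A, h z ≤ b + g z) (α : ι) :
    setPowInt μ t h A α ≤ EReal.exp b * setPowInt μ t g A α := by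
  have htα := ht α
  have key : ∫⁻ x in A, EReal.exp (h x / ((t α : ℝ) : EReal)) ∂(μ α) ≤
      EReal.exp ((b / t α : ℝ) : EReal) *
        ∫⁻ x in A, EReal.exp (g x / ((t α : ℝ) : EReal)) ∂(μ α) := by
    rw [← lintegral_const_mul' _ _ (by simp)]
    refine setLIntegral_mono' hA fun x hx => ?_
    rw [← EReal.exp_add, EReal.exp_le_exp_iff, EReal.coe_div]
    have h1 : (0 : EReal) ≤ ((t α : ℝ) : EReal)⁻¹ := by
      rw [← EReal.coe_inv]
      exact_mod_cast (inv_pos.2 htα).le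
    have h2 : ((t α : ℝ) : EReal)⁻¹ ≠ ⊤ := by
      rw [← EReal.coe_inv]
      exact EReal.coe_ne_top _
    calc h x / ((t α : ℝ) : EReal) ≤ (b + g x) / ((t α : ℝ) : EReal) :=
          EReal.div_le_div_right_of_nonneg (by exact_mod_cast htα.le) (hb x hx)
      _ = _ := by
          simp only [div_eq_mul_inv]
          exact EReal.right_distrib_of_nonneg_of_ne_top h1 h2 _ _
  calc setPowInt μ t h A α ≤ (EReal.exp ((b / t α : ℝ) : EReal) *
        ∫⁻ x in A, EReal.exp (g x / ((t α : ℝ) : EReal)) ∂(μ α)) ^ t α :=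
        ENNReal.rpow_le_rpow key htα.le
    _ = EReal.exp b * setPowInt μ t g A α := by
        rw [ENNReal.mul_rpow_of_nonneg _ _ htα.le, ← EReal.exp_mul, ← EReal.coe_mul,
          div_mul_cancel₀ _ htα.ne', setPowInt]

theorem limsup_setPowInt_union_le {F : Filter ι} (ht : ∀ α, 0 < t α) (ht0 : Tendsto t F (𝓝 0))
    (h : ℝ → EReal) (A B : Set ℝ) :
    limsup (setPowInt μ t h (A ∪ B)) F ≤
      max (limsup (setPowInt μ t h A) F) (limsup (setPowInt μ t h B) F) := by
  refine le_trans (limsup_le_limsup (Eventually.of_forall fun α => ?_))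
    (limsup_add_rpow_le ht ht0 _ _)
  exact ENNReal.rpow_le_rpow (lintegral_union_le _ _ _) (ht α).le

end Integrals

/-! ### The functions `rateZero` and `rateOne` -/

section Rates

variable {ι : Type*} [Preorder ι] {μ : ι → Measure ℝ} {t : ι → ℝ}

theorem exp_neg_rateZero (x : ℝ) : EReal.exp (-rateZero μ t x) =
    ⨅ (U : Set ℝ) (_ : IsOpen U ∧ x ∈ U), limsup (powMeas μ t U) atTop := by
  simp [rateZero]

theorem exp_neg_rateOne (x : ℝ) : EReal.exp (-rateOne μ t x) =
    ⨅ (U : Set ℝ) (_ : IsOpen U ∧ x ∈ U), liminf (powMeas μ t U) atTop := by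
  simp [rateOne]

theorem exp_neg_rateZero_le {U : Set ℝ} (hU : IsOpen U) {x : ℝ} (hx : x ∈ U) :
    EReal.exp (-rateZero μ t x) ≤ limsup (powMeas μ t U) atTop := by
  rw [exp_neg_rateZero]
  exact iInf₂_le U ⟨hU, hx⟩

theorem exp_neg_rateOne_le {U : Set ℝ} (hU : IsOpen U) {x : ℝ} (hx : x ∈ U) :
    EReal.exp (-rateOne μ t x) ≤ liminf (powMeas μ t U) atTop := by
  rw [exp_neg_rateOne]
  exact iInf₂_le U ⟨hU, hx⟩

theorem lowerSemicontinuous_neg_log_iInf_open (φ : Set ℝ → ℝ≥0∞) :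
    LowerSemicontinuous fun x : ℝ =>
      -ENNReal.log (⨅ (U : Set ℝ) (_ : IsOpen U ∧ x ∈ U), φ U) := by
  intro x y hy
  change y < -ENNReal.log _ at hy
  rw [EReal.lt_neg_comm, ← EReal.log_exp (-y), ENNReal.log_lt_log_iff] at hy
  simp only [iInf_lt_iff] at hy
  obtain ⟨U, ⟨hU, hxU⟩, hlt⟩ := hy
  filter_upwards [hU.mem_nhds hxU] with z hz
  change y < -ENNReal.log _
  rw [EReal.lt_neg_comm, ← EReal.log_exp (-y), ENNReal.log_lt_log_iff]
  exact (iInf₂_le U ⟨hU, hz⟩).trans_lt hlt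

theorem lowerSemicontinuous_rateOne : LowerSemicontinuous (rateOne μ t) :=
  lowerSemicontinuous_neg_log_iInf_open _

theorem rateZero_le_rateOne [IsDirectedOrder ι] [Nonempty ι] (x : ℝ) :
    rateZero μ t x ≤ rateOne μ t x := by
  rw [← EReal.neg_le_neg_iff, ← EReal.exp_le_exp_iff, exp_neg_rateZero, exp_neg_rateOne]
  exact iInf₂_mono fun U _ => liminf_le_limsup

theorem neg_lamUpper_zero_le_rateZero (x : ℝ) : -lamUpper μ t 0 ≤ rateZero μ t x := by
  rw [← EReal.neg_le_neg_iff, neg_neg, lamUpper, powInt_zero, ← EReal.exp_le_exp_iff,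
    ENNReal.exp_log]
  exact exp_neg_rateZero_le isOpen_univ (Set.mem_univ x)

theorem rateZero_nonneg [IsDirectedOrder ι] [Nonempty ι] (hμ : ∀ α, μ α Set.univ ≤ 1)
    (ht : ∀ α, 0 < t α) (x : ℝ) : 0 ≤ rateZero μ t x := by
  refine le_trans ?_ (neg_lamUpper_zero_le_rateZero x)
  rw [EReal.neg_nonneg, lamUpper, ENNReal.log_le_zero_iff, powInt_zero]
  exact limsup_le_of_le (by isBoundedDefault)
    (Eventually.of_forall fun α => ENNReal.rpow_le_one (hμ α) (ht α).le)

/-- The upper large deviation bound on compact sets always holds with rate function `rateZero`. -/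
theorem limsup_powMeas_le_of_isCompact [IsDirectedOrder ι] [Nonempty ι] (ht : ∀ α, 0 < t α)
    (ht0 : Tendsto t atTop (𝓝 0)) {K : Set ℝ} (hK : IsCompact K) :
    limsup (powMeas μ t K) atTop ≤ ⨆ x ∈ K, EReal.exp (-rateZero μ t x) := by
  refine le_of_forall_gt_imp_ge_of_dense fun c hc => ?_
  refine hK.induction_on (p := fun s => limsup (powMeas μ t s) atTop ≤ c) ?_ ?_ ?_ ?_
  · have : powMeas μ t ∅ = fun _ => 0 := by
      ext α
      simp [powMeas, ht α]
    simp [this]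
  · intro s u hsu hu
    exact (limsup_le_limsup (Eventually.of_forall (powMeas_mono ht hsu))).trans hu
  · intro s u hs hu
    rw [← setPowInt_zero] at *
    exact (limsup_setPowInt_union_le ht ht0 0 s u).trans (max_le hs hu)
  · intro x hx
    have hlt := (le_iSup₂ (f := fun x (_ : x ∈ K) => EReal.exp (-rateZero μ t x)) x hx).trans_lt hc
    simp only [exp_neg_rateZero, iInf_lt_iff] at hlt
    obtain ⟨U, ⟨hU, hxU⟩, hlt⟩ := hlt
    exact ⟨U, mem_nhdsWithin_of_mem_nhds (hU.mem_nhds hxU), hlt.le⟩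

/-- Once `rateOne ≤ rateZero`, a vague large deviation principle holds. -/
theorem isVagueLDP_of_rateOne_le [IsDirectedOrder ι] [Nonempty ι] (hμ : ∀ α, μ α Set.univ ≤ 1)
    (ht : ∀ α, 0 < t α) (ht0 : Tendsto t atTop (𝓝 0))
    (h : ∀ x, rateOne μ t x ≤ rateZero μ t x) : IsVagueLDP μ t (rateOne μ t) := by
  have heq : rateZero μ t = rateOne μ t := funext fun x => (rateZero_le_rateOne x).antisymm (h x)
  refine ⟨fun x => ?_, lowerSemicontinuous_rateOne, fun K hK => ?_, fun U hU => ?_⟩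
  · exact (rateZero_nonneg hμ ht x).trans (rateZero_le_rateOne x)
  · rw [← heq]
    exact limsup_powMeas_le_of_isCompact ht ht0 hK
  · exact iSup₂_le fun x hx => exp_neg_rateOne_le hU hx

/-- The lower half of Varadhan's integral lemma, for upper limits. -/
theorem sub_lamUpper_le_rateZero [IsDirectedOrder ι] [Nonempty ι] (ht : ∀ α, 0 < t α)
    {h : ℝ → EReal} {x : ℝ} (hc : ContinuousAt h x) :
    h x - lamUpper μ t h ≤ rateZero μ t x := by
  -- It suffices to bound `a - Λ(h)` for every real `a < h x`.
  have key : ∀ a : ℝ, (a : EReal) < h x → (a : EReal) - lamUpper μ t h ≤ rateZero μ t x := by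
    intro a ha
    obtain ⟨U, hUsub, hU, hxU⟩ := mem_nhds_iff.1 (hc.eventually_const_lt ha)
    have h1 : EReal.exp (-rateZero μ t x) ≤
        EReal.exp ((-a : ℝ) : EReal) * limsup (powInt μ t h) atTop := by
      refine (exp_neg_rateZero_le hU hxU).trans ?_
      rw [← limsup_const_mul_eq, ← setPowInt_zero, ← setPowInt_univ]
      refine limsup_le_limsup (Eventually.of_forall fun α => ?_)
      refine (setPowInt_le_exp_mul ht hU.measurableSet (g := h) (b := -a) (fun z hz => ?_) α).trans
        (mul_le_mul_right (setPowInt_mono ht h (Set.subset_univ U) α) _)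
      have hz' : (a : EReal) ≤ h z := (show (a : EReal) < h z from hUsub hz).le
      calc (0 : EReal) = ((-a : ℝ) : EReal) + (a : EReal) := by
            rw [← EReal.coe_add]
            simp
        _ ≤ _ := by gcongr
    have h2 : limsup (powInt μ t h) atTop = EReal.exp (lamUpper μ t h) := by simp [lamUpper]
    rw [h2, ← EReal.exp_add, EReal.exp_le_exp_iff] at h1
    rw [← EReal.neg_le_neg_iff]
    refine h1.trans (le_of_eq ?_)
    rw [EReal.neg_sub (by simp) (by simp), EReal.coe_neg]
  -- The degenerate values have to be separated, since `⊤ + ⊥ = ⊥` in `EReal`.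
  by_cases htop : lamUpper μ t h = ⊤
  · simp [htop]
  by_cases hbot : h x = ⊥
  · simp [hbot]
  by_cases hb : lamUpper μ t h = ⊥
  · obtain ⟨a, -, hax⟩ := EReal.lt_iff_exists_real_btwn.1 (bot_lt_iff_ne_bot.2 hbot)
    have h3 := key a hax
    rw [hb, EReal.coe_sub_bot, top_le_iff] at h3
    simp [h3]
  refine EReal.sub_le_of_le_add (le_of_forall_lt fun y hy => ?_)
  obtain ⟨a, hya, hax⟩ := EReal.lt_iff_exists_real_btwn.1 hy
  exact hya.trans_le ((EReal.sub_le_iff_le_add (Or.inl hb) (Or.inl htop)).1 (key a hax))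

end Rates

/-! ### Localization by exponential tilting -/

section Localization

variable {ι : Type*} [Preorder ι] {μ : ι → Measure ℝ} {t : ι → ℝ}

theorem limsup_powInt_lin {l : ℝ} (hl : logMGF μ t l ≠ ⊥ ∧ logMGF μ t l ≠ ⊤) :
    limsup (powInt μ t (lin l)) atTop = EReal.exp ((logMGF μ t l).toReal : ℝ) := by
  rw [EReal.coe_toReal hl.2 hl.1, logMGF, lam, lamUpper, ENNReal.exp_log]

theorem liminf_powInt_lin {l : ℝ} (hex : LamExists μ t (lin l))
    (hl : logMGF μ t l ≠ ⊥ ∧ logMGF μ t l ≠ ⊤) :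
    liminf (powInt μ t (lin l)) atTop = EReal.exp ((logMGF μ t l).toReal : ℝ) := by
  rw [EReal.coe_toReal hl.2 hl.1, logMGF, lam, ← hex, lamLower, ENNReal.exp_log]

/-- Chernoff's bound: on a set where `(l - k) z ≤ b`, the exponent `l` may be replaced by `k` at
the price of a factor `e^b`. -/
theorem limsup_setPowInt_lin_le [IsDirectedOrder ι] [Nonempty ι] (ht : ∀ α, 0 < t α) {l k b : ℝ}
    (hk : logMGF μ t k ≠ ⊥ ∧ logMGF μ t k ≠ ⊤) {A : Set ℝ} (hA : MeasurableSet A)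
    (hb : ∀ z ∈ A, (l - k) * z ≤ b) :
    limsup (setPowInt μ t (lin l) A) atTop ≤
      EReal.exp ((b + (logMGF μ t k).toReal : ℝ) : EReal) := by
  rw [EReal.coe_add, EReal.exp_add, ← limsup_powInt_lin hk, ← limsup_const_mul_eq]
  refine limsup_le_limsup (Eventually.of_forall fun α => ?_)
  rw [← setPowInt_univ]
  refine (setPowInt_le_exp_mul ht hA (g := lin k) (b := b) (fun z hz => ?_) α).trans
    (mul_le_mul_right (setPowInt_mono ht _ (Set.subset_univ A) α) _)
  have := hb z hz
  simp only [lin]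
  exact_mod_cast (by linarith : l * z ≤ b + k * z)

/-- If the exponentially tilted integral is not carried, in the limit, by the complement of a
neighbourhood of `x`, then that neighbourhood has measure at least `e^{L(l) - l x}`, up to the
oscillation of `l z` on it. -/
theorem exp_le_liminf_powMeas_Ioo [IsDirectedOrder ι] [Nonempty ι] (ht : ∀ α, 0 < t α)
    (ht0 : Tendsto t atTop (𝓝 0)) {l x ε : ℝ}
    (hex : LamExists μ t (lin l)) (hl : logMGF μ t l ≠ ⊥ ∧ logMGF μ t l ≠ ⊤)
    (hc : limsup (setPowInt μ t (lin l) (Set.Ioo (x - ε) (x + ε))ᶜ) atTop <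
      EReal.exp ((logMGF μ t l).toReal : ℝ)) :
    EReal.exp (((logMGF μ t l).toReal - l * x - |l| * ε : ℝ) : EReal) ≤
      liminf (powMeas μ t (Set.Ioo (x - ε) (x + ε))) atTop := by
  set A := Set.Ioo (x - ε) (x + ε) with hA
  have h1 : EReal.exp ((logMGF μ t l).toReal : ℝ) ≤ liminf (setPowInt μ t (lin l) A) atTop := by
    have h2 := liminf_add_rpow_le ht ht0
      (fun α => ∫⁻ z in A, EReal.exp (lin l z / ((t α : ℝ) : EReal)) ∂(μ α))
      (fun α => ∫⁻ z in Aᶜ, EReal.exp (lin l z / ((t α : ℝ) : EReal)) ∂(μ α))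
    have hsum (α : ι) := lintegral_add_compl (μ := μ α)
      (fun z => EReal.exp (lin l z / ((t α : ℝ) : EReal))) (measurableSet_Ioo : MeasurableSet A)
    have h3 : EReal.exp ((logMGF μ t l).toReal : ℝ) ≤
        max (liminf (setPowInt μ t (lin l) A) atTop) (limsup (setPowInt μ t (lin l) Aᶜ) atTop) := by
      rw [← liminf_powInt_lin hex hl]
      refine le_trans (le_of_eq (congrArg (liminf · atTop) (funext fun α => ?_))) h2
      exact congrArg (· ^ t α) (hsum α).symm
    exact (le_max_iff.1 h3).resolve_right hc.not_ge
  have h4 : liminf (setPowInt μ t (lin l) A) atTop ≤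
      EReal.exp ((l * x + |l| * ε : ℝ) : EReal) * liminf (powMeas μ t A) atTop := by
    rw [← liminf_const_mul_eq, ← setPowInt_zero]
    refine liminf_le_liminf (Eventually.of_forall fun α => ?_)
    refine setPowInt_le_exp_mul ht measurableSet_Ioo (fun z hz => ?_) α
    have : l * (z - x) ≤ |l| * ε := by
      refine (le_abs_self _).trans ?_
      rw [abs_mul]
      gcongr
      exact abs_le.2 ⟨by linarith [hz.1], by linarith [hz.2]⟩
    simp only [lin, Pi.zero_apply, add_zero]
    exact_mod_cast (by linarith : l * z ≤ l * x + |l| * ε)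
  calc EReal.exp (((logMGF μ t l).toReal - l * x - |l| * ε : ℝ) : EReal)
      = EReal.exp ((-(l * x + |l| * ε) : ℝ) : EReal) *
          EReal.exp ((logMGF μ t l).toReal : ℝ) := by
        rw [← EReal.exp_add, ← EReal.coe_add]
        congr 2
        ring
    _ ≤ EReal.exp ((-(l * x + |l| * ε) : ℝ) : EReal) *
          (EReal.exp ((l * x + |l| * ε : ℝ) : EReal) * liminf (powMeas μ t A) atTop) := by
        exact mul_le_mul_right (h1.trans h4) _
    _ = _ := by
        rw [← mul_assoc, ← EReal.exp_add, ← EReal.coe_add]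
        simp

/-- The errors `k ε` in exponential lower bounds for small intervals do not affect `rateOne`. -/
theorem rateOne_le_of_forall_Ioo (ht : ∀ α, 0 < t α) {x v k : ℝ}
    (h : ∀ ε > 0, EReal.exp ((v - k * ε : ℝ) : EReal) ≤
      liminf (powMeas μ t (Set.Ioo (x - ε) (x + ε))) atTop) :
    rateOne μ t x ≤ ((-v : ℝ) : EReal) := by
  rw [EReal.coe_neg, EReal.le_neg, ← EReal.exp_le_exp_iff, exp_neg_rateOne]
  refine le_iInf₂ fun U hU => ?_
  obtain ⟨δ, hδ, hball⟩ := Metric.isOpen_iff.1 hU.1 x hU.2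
  rw [Real.ball_eq_Ioo] at hball
  have hlim : Tendsto (fun ε : ℝ => EReal.exp ((v - k * ε : ℝ) : EReal)) (𝓝[>] 0)
      (𝓝 (EReal.exp v)) := by
    have : Continuous fun ε : ℝ => EReal.exp ((v - k * ε : ℝ) : EReal) :=
      ENNReal.continuous_exp.comp (continuous_coe_real_ereal.comp (by fun_prop))
    have h0 := this.tendsto 0
    simp only [mul_zero, sub_zero] at h0
    exact h0.mono_left nhdsWithin_le_nhds
  refine le_of_tendsto hlim ?_
  filter_upwards [Ioo_mem_nhdsGT hδ] with ε hε
  refine (h ε hε.1).trans (liminf_le_liminf (Eventually.of_forall fun α => ?_))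
  exact powMeas_mono ht
    ((Set.Ioo_subset_Ioo (by linarith [hε.2]) (by linarith [hε.2])).trans hball) α

theorem Ioo_compl_eq (x ε : ℝ) :
    (Set.Ioo (x - ε) (x + ε))ᶜ = Set.Iic (x - ε) ∪ Set.Ici (x + ε) := by
  ext z
  simp only [Set.mem_compl_iff, Set.mem_Ioo, Set.mem_union, Set.mem_Iic, Set.mem_Ici, not_and_or,
    not_lt]

/-- If difference quotients of `L` on the two sides of `l` lie on the right sides of `x ± ε`, then
tilting by `l` concentrates the mass near `x`. -/
theorem exp_le_liminf_powMeas_Ioo_of_slopes [IsDirectedOrder ι] [Nonempty ι] (ht : ∀ α, 0 < t α)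
    (ht0 : Tendsto t atTop (𝓝 0)) {l x ε η : ℝ} (hη : 0 < η)
    (hex : LamExists μ t (lin l)) (hl : logMGF μ t l ≠ ⊥ ∧ logMGF μ t l ≠ ⊤)
    (hl1 : logMGF μ t (l + η) ≠ ⊥ ∧ logMGF μ t (l + η) ≠ ⊤)
    (hl2 : logMGF μ t (l - η) ≠ ⊥ ∧ logMGF μ t (l - η) ≠ ⊤)
    (h1 : (logMGF μ t (l + η)).toReal - (logMGF μ t l).toReal < η * (x + ε))
    (h2 : η * (x - ε) < (logMGF μ t l).toReal - (logMGF μ t (l - η)).toReal) :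
    EReal.exp (((logMGF μ t l).toReal - l * x - |l| * ε : ℝ) : EReal) ≤
      liminf (powMeas μ t (Set.Ioo (x - ε) (x + ε))) atTop := by
  refine exp_le_liminf_powMeas_Ioo ht ht0 hex hl ?_
  -- The left tail is bounded with exponent `l - η`, the right tail with exponent `l + η`.
  rw [Ioo_compl_eq]
  refine (limsup_setPowInt_union_le ht ht0 _ _ _).trans_lt (max_lt ?_ ?_)
  · refine (limsup_setPowInt_lin_le ht (b := η * (x - ε)) hl2 measurableSet_Iic
      fun z hz => ?_).trans_lt ?_
    · rw [sub_sub_cancel]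
      exact mul_le_mul_of_nonneg_left hz hη.le
    · rw [EReal.exp_lt_exp_iff]
      exact_mod_cast (by linarith)
  · refine (limsup_setPowInt_lin_le ht (b := -(η * (x + ε))) hl1 measurableSet_Ici
      fun z hz => ?_).trans_lt ?_
    · have := mul_le_mul_of_nonneg_left (Set.mem_Ici.1 hz) hη.le
      linarith
    · rw [EReal.exp_lt_exp_iff]
      exact_mod_cast (by linarith)

end Localization

/-! ### Legendre-Fenchel transforms and one-sided derivatives -/

section Legendre

variable {ι : Type*} [Preorder ι] {μ : ι → Measure ℝ} {t : ι → ℝ} {G : Set ℝ}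

theorem le_logMGFStar {l : ℝ} (hl : l ∈ G) (hfin : logMGF μ t l ≠ ⊥ ∧ logMGF μ t l ≠ ⊤) (x : ℝ) :
    ((l * x - (logMGF μ t l).toReal : ℝ) : EReal) ≤ logMGFStar μ t G x := by
  refine le_trans (le_of_eq ?_) (le_iSup _ l)
  rw [extendTop, if_pos hl, EReal.coe_sub, EReal.coe_toReal hfin.2 hfin.1]

theorem logMGFStar_le_absLegendre {S : Set (ℝ → EReal)} (hGS : ∀ l ∈ G, lin l ∈ S) (x : ℝ) :
    logMGFStar μ t G x ≤ absLegendre μ t S x := by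
  refine iSup_le fun l => ?_
  by_cases hl : l ∈ G
  · rw [extendTop, if_pos hl]
    exact le_iSup₂ (f := fun (h : ℝ → EReal) (_ : h ∈ S) => h x - lam μ t h) (lin l) (hGS l hl)
  · rw [extendTop, if_neg hl, EReal.sub_top]
    exact bot_le

theorem absLegendre_le_rateZero [IsDirectedOrder ι] [Nonempty ι] (ht : ∀ α, 0 < t α)
    {S : Set (ℝ → EReal)} (hS : ∀ h ∈ S, Continuous h) (x : ℝ) :
    absLegendre μ t S x ≤ rateZero μ t x :=
  iSup₂_le fun h hh => sub_lamUpper_le_rateZero ht (hS h hh).continuousAt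

theorem neg_lamUpper_zero_le_logMGFStar (h0 : (0 : ℝ) ∈ G) (x : ℝ) :
    -lamUpper μ t 0 ≤ logMGFStar μ t G x := by
  refine le_trans (le_of_eq ?_) (le_iSup _ 0)
  rw [extendTop, if_pos h0, logMGF, lam, lin_zero]
  simp

/-- A quantitative consequence of one-sided differentiability: shifting `l` slightly to the side
where the derivative is taken gives a point around which symmetric difference quotients of `f` are
close to the derivative. Here `σ = ±1` is the side. -/
theorem exists_shift_of_eventually {f : ℝ → ℝ} {l x σ ε : ℝ} (hG : G ∈ 𝓝 l) (hσ : |σ| = 1)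
    (hε : 0 < ε)
    (hf : ∀ᶠ η in 𝓝[>] (0 : ℝ), |f (l + σ * η) - f l - σ * η * x| ≤ ε / 4 * η) :
    ∃ l' η, 0 < η ∧ l' ∈ G ∧ l' + η ∈ G ∧ l' - η ∈ G ∧
      f (l' + η) - f l' < η * (x + ε) ∧ η * (x - ε) < f l' - f (l' - η) ∧
      f l - l * x - (|l| + 1) * ε ≤ f l' - l' * x - |l'| * ε := by
  obtain ⟨δ, hδ, hball⟩ := Metric.mem_nhds_iff.1 hG
  obtain ⟨r, hr, hfr⟩ := mem_nhdsGT_iff_exists_Ioo_subset.1 hf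
  have hr : 0 < r := hr
  obtain ⟨η, hη, hηm⟩ : ∃ η : ℝ, 0 < η ∧ η < min (1 / 2) (min (δ / 2) (r / 2)) :=
    exists_between (by positivity)
  simp only [lt_min_iff] at hηm
  obtain ⟨hη1, hηδ, hηr⟩ := hηm
  have hGmem : ∀ y, |y - l| < δ → y ∈ G := fun y hy => hball (by
    rw [Metric.mem_ball, Real.dist_eq]
    exact hy)
  have e1 := hfr ⟨hη, by linarith⟩
  have e2 := hfr (show 2 * η ∈ Set.Ioo 0 r from ⟨by linarith, by linarith⟩)
  simp only [Set.mem_ofPred_eq, abs_le] at e1 e2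
  have hεη : 0 < ε * η := mul_pos hε hη
  have habs : |l + σ * η| ≤ |l| + η := by
    refine (abs_add_le _ _).trans ?_
    rw [abs_mul, hσ, one_mul, abs_of_pos hη]
  have hlast : f l - l * x - (|l| + 1) * ε ≤ f (l + σ * η) - (l + σ * η) * x - |l + σ * η| * ε := by
    nlinarith [mul_le_mul_of_nonneg_right habs hε.le]
  rcases (abs_eq zero_le_one).1 hσ with rfl | rfl
  · refine ⟨l + 1 * η, η, hη, hGmem _ ?_, hGmem _ ?_, hGmem _ ?_, ?_, ?_, hlast⟩
    · rw [abs_lt]; constructor <;> linarith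
    · rw [abs_lt]; constructor <;> linarith
    · rw [abs_lt]; constructor <;> linarith
    · rw [show l + 1 * η + η = l + 1 * (2 * η) by ring]
      linarith [e1.1, e2.2]
    · rw [show l + 1 * η - η = l by ring]
      linarith [e1.1]
  · refine ⟨l + -1 * η, η, hη, hGmem _ ?_, hGmem _ ?_, hGmem _ ?_, ?_, ?_, hlast⟩
    · rw [abs_lt]; constructor <;> linarith
    · rw [abs_lt]; constructor <;> linarith
    · rw [abs_lt]; constructor <;> linarith
    · rw [show l + -1 * η + η = l by ring]
      linarith [e1.1]
    · rw [show l + -1 * η - η = l + -1 * (2 * η) by ring]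
      linarith [e1.1, e2.2]

theorem eventually_abs_sub_le_of_hasDerivWithinAt {f : ℝ → ℝ} {s : Set ℝ} {l x σ ε : ℝ}
    (hε : 0 < ε) (hσ : |σ| = 1) (hf : HasDerivWithinAt f x s l)
    (hs : ∀ᶠ η in 𝓝[>] (0 : ℝ), l + σ * η ∈ s) :
    ∀ᶠ η in 𝓝[>] (0 : ℝ), |f (l + σ * η) - f l - σ * η * x| ≤ ε / 4 * η := by
  have h1 := (hasDerivWithinAt_iff_isLittleO.1 hf).def (show 0 < ε / 4 by positivity)
  have h2 : Tendsto (fun η => l + σ * η) (𝓝[>] (0 : ℝ)) (𝓝[s] l) := by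
    refine tendsto_nhdsWithin_iff.2 ⟨?_, hs⟩
    have : Continuous fun η => l + σ * η := by fun_prop
    have h0 := this.tendsto 0
    simp only [mul_zero, add_zero] at h0
    exact h0.mono_left nhdsWithin_le_nhds
  filter_upwards [h2.eventually h1, self_mem_nhdsWithin] with η hη hpos
  have hpos : 0 < η := hpos
  simpa [Real.norm_eq_abs, abs_mul, hσ, abs_of_pos hpos] using hη

/-- The crux: at a value `x` of a one-sided derivative of `L`, `rateOne` is at most the
Legendre-Fenchel transform. -/
theorem rateOne_le_logMGFStar_of_mem_ranSided [IsDirectedOrder ι] [Nonempty ι]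
    (ht : ∀ α, 0 < t α) (ht0 : Tendsto t atTop (𝓝 0)) (hG : IsOpen G)
    (hex : ∀ l ∈ G, LamExists μ t (lin l)) (hL : ∀ l ∈ G, logMGF μ t l ≠ ⊥ ∧ logMGF μ t l ≠ ⊤)
    {x : ℝ} (hx : x ∈ ranSided (logMGF μ t) G) :
    rateOne μ t x ≤ logMGFStar μ t G x := by
  obtain ⟨l, hl, σ, hσ, hf⟩ : ∃ l ∈ G, ∃ σ : ℝ, |σ| = 1 ∧ ∀ ε > 0, ∀ᶠ η in 𝓝[>] (0 : ℝ),
      |(logMGF μ t (l + σ * η)).toReal - (logMGF μ t l).toReal - σ * η * x| ≤ ε / 4 * η := by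
    have hmem : ∀ (l : ℝ), l ∈ G → ∀ σ : ℝ, ∀ᶠ η in 𝓝[>] (0 : ℝ), l + σ * η ∈ G := by
      intro l hl σ
      have : Continuous fun η => l + σ * η := by fun_prop
      exact nhdsWithin_le_nhds
        (this.continuousAt.preimage_mem_nhds (by simpa using hG.mem_nhds hl))
    rcases hx with ⟨l, hl, hd⟩ | ⟨l, hl, hd⟩
    · refine ⟨l, hl, -1, by simp, fun ε hε =>
        eventually_abs_sub_le_of_hasDerivWithinAt (f := fun s => (logMGF μ t s).toReal) hε
          (by simp) hd ?_⟩
      filter_upwards [hmem l hl (-1), self_mem_nhdsWithin] with η h1 h2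
      have h2 : 0 < η := h2
      exact ⟨h1, by simpa using h2⟩
    · refine ⟨l, hl, 1, by simp, fun ε hε =>
        eventually_abs_sub_le_of_hasDerivWithinAt (f := fun s => (logMGF μ t s).toReal) hε
          (by simp) hd ?_⟩
      filter_upwards [hmem l hl 1, self_mem_nhdsWithin] with η h1 h2
      have h2 : 0 < η := h2
      exact ⟨h1, by simpa using h2⟩
  refine le_trans ?_ (le_logMGFStar hl (hL l hl) x)
  rw [← neg_sub]
  refine rateOne_le_of_forall_Ioo (k := |l| + 1) ht fun ε hε => ?_
  obtain ⟨l', η, hη, h0, h1, h2, h3, h4, h5⟩ :=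
    exists_shift_of_eventually (f := fun s => (logMGF μ t s).toReal) (hG.mem_nhds hl) hσ hε
      (hf ε hε)
  refine le_trans ?_ (exp_le_liminf_powMeas_Ioo_of_slopes ht ht0 hη (hex l' h0) (hL l' h0)
    (hL _ h1) (hL _ h2) h3 h4)
  rw [EReal.exp_le_exp_iff]
  exact_mod_cast h5

end Legendre

/-! ### Exponential tightness -/

section Tightness

variable {ι : Type*} [Preorder ι] {μ : ι → Measure ℝ} {t : ι → ℝ} {G : Set ℝ}

/-- Exponential tightness of the integrals tilted by an interior point `l` of the domain of `L`. -/
theorem exists_limsup_tails_lt [IsDirectedOrder ι] [Nonempty ι]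
    (ht : ∀ α, 0 < t α) (ht0 : Tendsto t atTop (𝓝 0)) (hG : IsOpen G)
    (hL : ∀ l ∈ G, logMGF μ t l ≠ ⊥ ∧ logMGF μ t l ≠ ⊤) {l : ℝ} (hl : l ∈ G)
    {c : ℝ≥0∞} (hc : 0 < c) :
    ∃ M : ℝ, limsup (setPowInt μ t (lin l) (Set.Iic (-M) ∪ Set.Ici M)) atTop < c := by
  obtain ⟨δ, hδ, hball⟩ := Metric.isOpen_iff.1 hG l hl
  have hmem : ∀ y, |y - l| < δ → y ∈ G := fun y hy => hball (by
    rw [Metric.mem_ball, Real.dist_eq]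
    exact hy)
  have h1 := hL (l + δ / 2) (hmem _ (by rw [abs_lt]; constructor <;> linarith))
  have h2 := hL (l - δ / 2) (hmem _ (by rw [abs_lt]; constructor <;> linarith))
  have hlim : ∀ b : ℝ, ∀ᶠ M : ℝ in atTop, EReal.exp ((-(δ / 2 * M) + b : ℝ) : EReal) < c := by
    intro b
    have hreal : Tendsto (fun M : ℝ => -(δ / 2 * M) + b) atTop atBot :=
      tendsto_atBot_add_const_right _ _
        (tendsto_neg_atTop_atBot.comp (tendsto_id.const_mul_atTop (by positivity)))
    have : Tendsto (fun M : ℝ => EReal.exp ((-(δ / 2 * M) + b : ℝ) : EReal)) atTop (𝓝 0) :=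
      EReal.tendsto_exp_nhds_bot_nhds_zero.comp (EReal.tendsto_coe_nhds_bot_iff.2 hreal)
    exact this.eventually_lt_const hc
  obtain ⟨M, hM1, hM2⟩ := ((hlim (logMGF μ t (l + δ / 2)).toReal).and
    (hlim (logMGF μ t (l - δ / 2)).toReal)).exists
  refine ⟨M, (limsup_setPowInt_union_le ht ht0 _ _ _).trans_lt (max_lt ?_ ?_)⟩
  · refine (limsup_setPowInt_lin_le ht h2 measurableSet_Iic fun z hz => ?_).trans_lt hM2
    have := mul_le_mul_of_nonneg_left (Set.mem_Iic.1 hz) (half_pos hδ).le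
    linarith
  · refine (limsup_setPowInt_lin_le ht h1 measurableSet_Ici fun z hz => ?_).trans_lt hM1
    have := mul_le_mul_of_nonneg_left (Set.mem_Ici.1 hz) (half_pos hδ).le
    linarith

theorem subset_tails_union_inter (A : Set ℝ) (M : ℝ) :
    A ⊆ (Set.Iic (-M) ∪ Set.Ici M) ∪ (A ∩ Set.Icc (-M) M) := by
  intro z hz
  rcases le_total z (-M) with h | h
  · exact Or.inl (Or.inl h)
  · rcases le_total M z with h' | h'
    · exact Or.inl (Or.inr h')
    · exact Or.inr ⟨hz, h, h'⟩

/-- If `L` is finite near `0`, exponential tightness makes the large deviation principle narrow. -/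
theorem isNarrowLDP_of_rateOne_le [IsDirectedOrder ι] [Nonempty ι] (hμ : ∀ α, μ α Set.univ ≤ 1)
    (ht : ∀ α, 0 < t α) (ht0 : Tendsto t atTop (𝓝 0)) (hG : IsOpen G)
    (hL : ∀ l ∈ G, logMGF μ t l ≠ ⊥ ∧ logMGF μ t l ≠ ⊤) (h0 : (0 : ℝ) ∈ G)
    (h : ∀ x, rateOne μ t x ≤ rateZero μ t x) : IsNarrowLDP μ t (rateOne μ t) := by
  have hv := isVagueLDP_of_rateOne_le hμ ht ht0 h
  refine ⟨hv.nonneg, hv.lsc, fun A hA => ?_, hv.lower⟩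
  refine le_of_forall_gt_imp_ge_of_dense fun c hc => ?_
  obtain ⟨M, hM⟩ := exists_limsup_tails_lt ht ht0 hG hL h0 (bot_le.trans_lt hc)
  rw [lin_zero] at hM
  have hcomp : limsup (setPowInt μ t 0 (A ∩ Set.Icc (-M) M)) atTop ≤ c := by
    rw [setPowInt_zero]
    refine (hv.upper _ (isCompact_Icc.inter_left hA)).trans (le_trans ?_ hc.le)
    exact biSup_mono fun x hx => hx.1
  rw [← setPowInt_zero]
  exact (limsup_le_limsup (Eventually.of_forall fun α =>
    setPowInt_mono ht 0 (subset_tails_union_inter A M) α)).trans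
    ((limsup_setPowInt_union_le ht ht0 _ _ _).trans (max_le hM.le hcomp))

/-- If `rateZero` is infinite off `x`, tilted integrals with exponent in `G` concentrate at `x`:
the tails are exponentially small, and compact sets away from `x` carry no mass. -/
theorem rateOne_le_logMGFStar_of_forall_ne [IsDirectedOrder ι] [Nonempty ι]
    (ht : ∀ α, 0 < t α) (ht0 : Tendsto t atTop (𝓝 0)) (hG : IsOpen G) (hGne : G.Nonempty)
    (hex : ∀ l ∈ G, LamExists μ t (lin l)) (hL : ∀ l ∈ G, logMGF μ t l ≠ ⊥ ∧ logMGF μ t l ≠ ⊤)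
    {x : ℝ} (hx : ∀ y, y ≠ x → rateZero μ t y = ⊤) :
    rateOne μ t x ≤ logMGFStar μ t G x := by
  obtain ⟨l, hl⟩ := hGne
  refine le_trans ?_ (le_logMGFStar hl (hL l hl) x)
  rw [← neg_sub]
  refine rateOne_le_of_forall_Ioo (k := |l|) ht fun ε hε => ?_
  refine exp_le_liminf_powMeas_Ioo ht ht0 (hex l hl) (hL l hl) ?_
  have hpos : 0 < EReal.exp (((logMGF μ t l).toReal : ℝ) : EReal) :=
    EReal.zero_lt_exp_iff.2 (EReal.bot_lt_coe _)
  obtain ⟨M, hM⟩ := exists_limsup_tails_lt ht ht0 hG hL hl hpos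
  set A := (Set.Ioo (x - ε) (x + ε))ᶜ with hA
  have hAc : IsClosed A := isOpen_Ioo.isClosed_compl
  have hK : IsCompact (A ∩ Set.Icc (-M) M) := isCompact_Icc.inter_left hAc
  have hcomp : limsup (setPowInt μ t (lin l) (A ∩ Set.Icc (-M) M)) atTop ≤ 0 := by
    calc limsup (setPowInt μ t (lin l) (A ∩ Set.Icc (-M) M)) atTop
        ≤ EReal.exp ((|l| * M : ℝ) : EReal) * limsup (powMeas μ t (A ∩ Set.Icc (-M) M)) atTop := by
          rw [← limsup_const_mul_eq, ← setPowInt_zero]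
          refine limsup_le_limsup (Eventually.of_forall fun α => ?_)
          refine setPowInt_le_exp_mul ht hK.measurableSet (fun z hz => ?_) α
          have : l * z ≤ |l| * M := by
            refine (le_abs_self _).trans ?_
            rw [abs_mul]
            gcongr
            exact abs_le.2 hz.2
          simp only [lin, Pi.zero_apply, add_zero]
          exact_mod_cast this
      _ ≤ EReal.exp ((|l| * M : ℝ) : EReal) * 0 := by
          refine mul_le_mul_right ((limsup_powMeas_le_of_isCompact ht ht0 hK).trans ?_) _
          refine iSup₂_le fun z hz => ?_
          have hne : z ≠ x := by
            rintro rfl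
            exact hz.1 ⟨by linarith, by linarith⟩
          simp [hx z hne]
      _ = 0 := mul_zero _
  exact (limsup_le_limsup (Eventually.of_forall fun α =>
    setPowInt_mono ht _ (subset_tails_union_inter A M) α)).trans_lt
    ((limsup_setPowInt_union_le ht ht0 _ _ _).trans_lt (max_lt hM (hcomp.trans_lt hpos)))

end Tightness

/-! ### Extension to the boundary of a convex domain -/

section Convexity

theorem IsProperConvex.le_of_le {f : ℝ → EReal} (hf : IsProperConvex f) {x y a b s : ℝ}
    (hx : f x ≤ a) (hy : f y ≤ b) (hs0 : 0 ≤ s) (hs1 : s ≤ 1) :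
    f ((1 - s) * x + s * y) ≤ (((1 - s) * a + s * b : ℝ) : EReal) := by
  obtain ⟨hconv, -⟩ := hf
  have := hconv (show (x, a) ∈ {p : ℝ × ℝ | f p.1 ≤ (p.2 : EReal)} from hx)
    (show (y, b) ∈ {p : ℝ × ℝ | f p.1 ≤ (p.2 : EReal)} from hy) (sub_nonneg.2 hs1) hs0 (by ring)
  simpa using this

theorem IsProperConvex.convex_dom {f : ℝ → EReal} (hf : IsProperConvex f) : Convex ℝ (Dom f) := by
  intro x hx y hy a b ha hb hab
  obtain ⟨p, hp, -⟩ := EReal.lt_iff_exists_real_btwn.1 (show f x < ⊤ from hx)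
  obtain ⟨q, hq, -⟩ := EReal.lt_iff_exists_real_btwn.1 (show f y < ⊤ from hy)
  have := hf.le_of_le hp.le hq.le hb (by linarith)
  rw [show a = 1 - b by linarith]
  exact this.trans_lt (EReal.coe_lt_top _)

/-- A lower semicontinuous function that is at most `max c f`, `f` convex, on the interior of the
domain of `f` is so at each boundary point too: approach it along a segment. -/
theorem IsProperConvex.le_max_of_forall_interior {f g : ℝ → EReal} {c : EReal}
    (hf : IsProperConvex f) (hg : LowerSemicontinuous g)
    (h : ∀ x ∈ interior (Dom f), g x ≤ max c (f x)) {x y : ℝ} (hy : y ∈ Dom f) (hxy : y ≠ x) :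
    g x ≤ max c (f x) := by
  by_contra! hlt
  obtain ⟨d, hd, hdg⟩ := EReal.lt_iff_exists_real_btwn.1 hlt
  obtain ⟨a, ha, had⟩ := EReal.lt_iff_exists_real_btwn.1 hd
  obtain ⟨b, hb, -⟩ := EReal.lt_iff_exists_real_btwn.1 (show f y < ⊤ from hy)
  have had : a < d := by exact_mod_cast had
  have hx : x ∈ Dom f := ((le_max_right _ _).trans_lt ha).trans (EReal.coe_lt_top _)
  have hev1 : ∀ᶠ s in 𝓝[>] (0 : ℝ), (d : EReal) < g ((1 - s) * x + s * y) := by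
    have hcont : Continuous fun s : ℝ => (1 - s) * x + s * y := by fun_prop
    have h0 := hcont.tendsto 0
    simp only [sub_zero, one_mul, zero_mul, add_zero] at h0
    exact (h0.mono_left nhdsWithin_le_nhds).eventually (hg x d hdg)
  have hev2 : ∀ᶠ s in 𝓝[>] (0 : ℝ), (1 - s) * a + s * b < d := by
    have hcont : Continuous fun s : ℝ => (1 - s) * a + s * b := by fun_prop
    have h0 := hcont.tendsto 0
    simp only [sub_zero, one_mul, zero_mul, add_zero] at h0
    exact (h0.mono_left nhdsWithin_le_nhds).eventually_lt_const had
  obtain ⟨s, hs1, hs2, hs⟩ := (hev1.and (hev2.and (Ioo_mem_nhdsGT (zero_lt_one' ℝ)))).exists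
  have hint : (1 - s) * x + s * y ∈ interior (Dom f) := by
    have hsub : Set.Ioo (min x y) (max x y) ⊆ Dom f := fun z hz =>
      hf.convex_dom.ordConnected.uIcc_subset hx hy (Set.Ioo_subset_Icc_self hz)
    refine interior_maximal hsub isOpen_Ioo ?_
    rcases lt_or_gt_of_ne hxy with hyx | hyx
    · rw [min_eq_right hyx.le, max_eq_left hyx.le]
      constructor <;> nlinarith [hs.1, hs.2, sub_pos.2 hyx]
    · rw [min_eq_left hyx.le, max_eq_right hyx.le]
      constructor <;> nlinarith [hs.1, hs.2, sub_pos.2 hyx]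
  rcases le_max_iff.1 (hs1.le.trans (h _ hint)) with h1 | h1
  · exact absurd (h1.trans (le_max_left _ (f x))) hd.not_ge
  · have h2 := h1.trans (hf.le_of_le ((le_max_right _ _).trans ha.le) hb.le hs.1.le hs.2.le)
    exact absurd (by exact_mod_cast h2 : d ≤ (1 - s) * a + s * b) hs2.not_ge

end Convexity

section Main

variable {ι : Type*} [Preorder ι] {μ : ι → Measure ℝ} {t : ι → ℝ} {G : Set ℝ}

/-- To compare `rateOne` with a proper convex `f` between the Legendre-Fenchel transform and
`rateZero`, it suffices to do so on the interior of the domain of `f`. If the domain has empty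
interior, it is a point, and then the comparison is automatic. -/
theorem rateOne_le_max_of_forall_interior [IsDirectedOrder ι] [Nonempty ι]
    (ht : ∀ α, 0 < t α) (ht0 : Tendsto t atTop (𝓝 0)) (hG : IsOpen G) (hGne : G.Nonempty)
    (hex : ∀ l ∈ G, LamExists μ t (lin l)) (hL : ∀ l ∈ G, logMGF μ t l ≠ ⊥ ∧ logMGF μ t l ≠ ⊤)
    {f : ℝ → EReal} {c : EReal} (hf : IsProperConvex f) (hLf : ∀ x, logMGFStar μ t G x ≤ f x)
    (hf0 : ∀ x, f x ≤ rateZero μ t x)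
    (h : ∀ x ∈ interior (Dom f), rateOne μ t x ≤ max c (f x)) (x : ℝ) :
    rateOne μ t x ≤ max c (f x) := by
  by_cases hy : ∃ y ∈ Dom f, y ≠ x
  · obtain ⟨y, hy, hyx⟩ := hy
    exact hf.le_max_of_forall_interior lowerSemicontinuous_rateOne h hy hyx
  · refine (rateOne_le_logMGFStar_of_forall_ne ht ht0 hG hGne hex hL fun y hyx => ?_).trans
      ((hLf x).trans (le_max_right _ _))
    by_contra hne
    exact hy ⟨y, (hf0 y).trans_lt (lt_top_iff_ne_top.2 hne), hyx⟩

end Main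

end NetLDP

/-! ### The large deviation theorem -/

open NetLDP
theorem mainTheorem1 {ι : Type*} [Preorder ι] [IsDirectedOrder ι] [Nonempty ι]
    (μ : ι → Measure ℝ) (hμ : ∀ α, μ α Set.univ ≤ 1)
    (t : ι → ℝ) (ht : ∀ α, 0 < t α) (ht0 : Tendsto t atTop (𝓝 0))
    (S : Set (ℝ → EReal)) (hS : ∀ h ∈ S, Continuous h ∧ ∀ x, h x ≠ ⊤)
    (G : Set ℝ) (hGopen : IsOpen G) (hGint : G.OrdConnected) (hGne : G.Nonempty)
    (hGS : ∀ l ∈ G, lin l ∈ S)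
    (hLam : ∀ h ∈ S, LamExists μ t h)
    (hL : ∀ l ∈ G, logMGF μ t l ≠ ⊥ ∧ logMGF μ t l ≠ ⊤) :
    -- (a)
    (Dom (rateZero μ t) ∩ {x | -lamUpper μ t 0 < rateOne μ t x} ⊆ ranSided (logMGF μ t) G →
      ∃ J : ℝ → EReal, IsVagueLDP μ t J ∧
        (∀ x ∈ Dom J ∩ {x | -lamUpper μ t 0 < J x},
          J x = logMGFStar μ t G x ∧ J x = absLegendre μ t S x) ∧
        ((0 : ℝ) ∈ G → IsNarrowLDP μ t J ∧
          ∀ x ∈ Dom J, J x = logMGFStar μ t G x ∧ J x = absLegendre μ t S x)) ∧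
    -- (b)
    (Dom (rateZero μ t) ⊆ ranSided (logMGF μ t) G →
      ∃ J : ℝ → EReal, IsVagueLDP μ t J ∧
        (∀ x ∈ Dom J, J x = logMGFStar μ t G x ∧ J x = absLegendre μ t S x) ∧
        ((0 : ℝ) ∈ G → IsNarrowLDP μ t J)) ∧
    -- (c)
    (Dom (absLegendre μ t S) ∩ {x | -lamUpper μ t 0 < rateOne μ t x} ⊆
        ranSided (logMGF μ t) G →
      ∃ J : ℝ → EReal, IsVagueLDP μ t J ∧
        (∀ x ∈ {x | -lamUpper μ t 0 < J x}, J x = absLegendre μ t S x) ∧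
        (∀ x ∈ Dom (absLegendre μ t S) ∩ {x | -lamUpper μ t 0 < J x},
          J x = logMGFStar μ t G x) ∧
        ((0 : ℝ) ∈ G → IsNarrowLDP μ t J ∧ J = absLegendre μ t S ∧
          ∀ x ∈ Dom J, J x = logMGFStar μ t G x)) ∧
    -- (d)
    (Dom (absLegendre μ t S) ⊆ ranSided (logMGF μ t) G →
      ∃ J : ℝ → EReal, IsVagueLDP μ t J ∧ J = absLegendre μ t S ∧
        (∀ x ∈ Dom J, J x = logMGFStar μ t G x) ∧
        ((0 : ℝ) ∈ G → IsNarrowLDP μ t J)) ∧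
    -- (e)
    (IsProperConvex (rateZero μ t) →
      (interior (Dom (rateZero μ t)) ∩ {x | -lamUpper μ t 0 < rateOne μ t x} ⊆
          ranSided (logMGF μ t) G →
        ∃ J : ℝ → EReal, IsVagueLDP μ t J ∧
          (∀ x ∈ interior (Dom J) ∩ {x | -lamUpper μ t 0 < J x},
            J x = logMGFStar μ t G x ∧ J x = absLegendre μ t S x) ∧
          ((0 : ℝ) ∈ G → IsNarrowLDP μ t J ∧
            ∀ x ∈ interior (Dom J),
              J x = logMGFStar μ t G x ∧ J x = absLegendre μ t S x)) ∧
      (interior (Dom (rateZero μ t)) ⊆ ranSided (logMGF μ t) G →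
        ∃ J : ℝ → EReal, IsVagueLDP μ t J ∧
          (∀ x ∈ interior (Dom J),
            J x = logMGFStar μ t G x ∧ J x = absLegendre μ t S x) ∧
          ((0 : ℝ) ∈ G → IsNarrowLDP μ t J))) ∧
    -- (f)
    (IsProperConvex (absLegendre μ t S) → LowerSemicontinuous (absLegendre μ t S) →
      (interior (Dom (absLegendre μ t S)) ∩ {x | -lamUpper μ t 0 < rateOne μ t x} ⊆
          ranSided (logMGF μ t) G →
        ∃ J : ℝ → EReal, IsVagueLDP μ t J ∧
          (∀ x ∈ {x | -lamUpper μ t 0 < J x}, J x = absLegendre μ t S x) ∧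
          (∀ x ∈ interior (Dom (absLegendre μ t S)) ∩ {x | -lamUpper μ t 0 < J x},
            J x = logMGFStar μ t G x) ∧
          ((0 : ℝ) ∈ G → IsNarrowLDP μ t J ∧ J = absLegendre μ t S ∧
            ∀ x ∈ interior (Dom J), J x = logMGFStar μ t G x)) ∧
      (interior (Dom (absLegendre μ t S)) ⊆ ranSided (logMGF μ t) G →
        ∃ J : ℝ → EReal, IsVagueLDP μ t J ∧ J = absLegendre μ t S ∧
          (∀ x ∈ interior (Dom J), J x = logMGFStar μ t G x) ∧
          ((0 : ℝ) ∈ G → IsNarrowLDP μ t J))) := by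
  have hLam' : ∀ l ∈ G, LamExists μ t (lin l) := fun l hl => hLam _ (hGS l hl)
  have h01 : ∀ x, rateZero μ t x ≤ rateOne μ t x := rateZero_le_rateOne
  have hc0 : ∀ x, -lamUpper μ t 0 ≤ rateZero μ t x := neg_lamUpper_zero_le_rateZero
  have hA0 : ∀ x, absLegendre μ t S x ≤ rateZero μ t x :=
    absLegendre_le_rateZero ht fun h hh => (hS h hh).1
  have hLA : ∀ x, logMGFStar μ t G x ≤ absLegendre μ t S x := logMGFStar_le_absLegendre hGS
  have hR : ∀ x ∈ ranSided (logMGF μ t) G, rateOne μ t x ≤ logMGFStar μ t G x := fun x hx =>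
    rateOne_le_logMGFStar_of_mem_ranSided ht ht0 hGopen hLam' hL hx
  have hcL : (0 : ℝ) ∈ G → ∀ x, -lamUpper μ t 0 ≤ logMGFStar μ t G x :=
    neg_lamUpper_zero_le_logMGFStar
  have hvague := isVagueLDP_of_rateOne_le hμ ht ht0
  have hnarrow := isNarrowLDP_of_rateOne_le hμ ht ht0 hGopen hL
  have hA1 : ∀ x, absLegendre μ t S x ≤ rateOne μ t x := fun x => (hA0 x).trans (h01 x)
  have hDom01 : Dom (rateOne μ t) ⊆ Dom (rateZero μ t) := fun x hx => (h01 x).trans_lt hx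
  have hDomA : Dom (rateZero μ t) ⊆ Dom (absLegendre μ t S) := fun x hx => (hA0 x).trans_lt hx
  have hDomA1 : Dom (rateOne μ t) ⊆ Dom (absLegendre μ t S) := hDom01.trans hDomA
  -- Where `rateOne ≤ L*`, the chain `L* ≤ Λ* ≤ rateOne` collapses.
  have heqL : ∀ x, rateOne μ t x ≤ logMGFStar μ t G x →
      rateOne μ t x = logMGFStar μ t G x ∧ rateOne μ t x = absLegendre μ t S x := fun x hx =>
    ⟨hx.antisymm ((hLA x).trans (hA1 x)), (hx.trans (hLA x)).antisymm (hA1 x)⟩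
  -- A bound on the domain of `f`, or on its interior if `f` is convex, is a bound everywhere.
  have hextend : ∀ (f : ℝ → EReal) (c : EReal), IsProperConvex f →
      (∀ x, logMGFStar μ t G x ≤ f x) → (∀ x, f x ≤ rateZero μ t x) →
      (∀ x ∈ interior (Dom f), rateOne μ t x ≤ max c (f x)) → ∀ x, rateOne μ t x ≤ max c (f x) :=
    fun f c hf h1 h2 h => rateOne_le_max_of_forall_interior ht ht0 hGopen hGne hLam' hL hf h1 h2 h
  have hL0 : ∀ x, logMGFStar μ t G x ≤ rateZero μ t x := fun x => (hLA x).trans (hA0 x)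
  have hDomTop : ∀ (f : ℝ → EReal) (c : EReal),
      (∀ x ∈ Dom f, rateOne μ t x ≤ max c (f x)) → ∀ x, rateOne μ t x ≤ max c (f x) := by
    intro f c h x
    by_cases hx : x ∈ Dom f
    · exact h x hx
    · exact le_max_of_le_right (le_top.trans (not_lt.1 hx))
  -- The hypothesis on one-sided derivatives bounds `rateOne` on the set `D` it concerns.
  have hbound : ∀ (f : ℝ → EReal) (D : Set ℝ), (∀ x, logMGFStar μ t G x ≤ f x) →
      D ∩ {x | -lamUpper μ t 0 < rateOne μ t x} ⊆ ranSided (logMGF μ t) G →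
      ∀ x ∈ D, rateOne μ t x ≤ max (-lamUpper μ t 0) (f x) := by
    intro f D hf hD x hx
    by_cases hlt : -lamUpper μ t 0 < rateOne μ t x
    · exact le_max_of_le_right ((hR x (hD ⟨hx, hlt⟩)).trans (hf x))
    · exact le_max_of_le_left (not_lt.1 hlt)
  have hbound' : ∀ (f : ℝ → EReal) (D : Set ℝ), (∀ x, logMGFStar μ t G x ≤ f x) →
      D ⊆ ranSided (logMGF μ t) G → ∀ x ∈ D, rateOne μ t x ≤ max ⊥ (f x) := fun f D hf hD x hx =>
    le_max_of_le_right ((hR x (hD hx)).trans (hf x))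
  -- With `0 ∈ G`, the points where `rateOne ≤ -Λ̄(0)` cause no exception.
  have hzero : (0 : ℝ) ∈ G → ∀ x, (-lamUpper μ t 0 < rateOne μ t x →
      rateOne μ t x ≤ logMGFStar μ t G x) → rateOne μ t x ≤ logMGFStar μ t G x := by
    intro h0 x h
    by_cases hlt : -lamUpper μ t 0 < rateOne μ t x
    · exact h hlt
    · exact (not_lt.1 hlt).trans (hcL h0 x)
  -- The hypotheses on the domain of `Λ*` also identify the rate with `Λ*`. Here `D` is that
  -- domain or its interior, and `D'` is the domain of the rate or its interior.
  have hconclude : ∀ D D' : Set ℝ,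
      (∀ x, rateOne μ t x ≤ max (-lamUpper μ t 0) (absLegendre μ t S x)) →
      (∀ x ∈ D, -lamUpper μ t 0 < rateOne μ t x → rateOne μ t x ≤ logMGFStar μ t G x) →
      D' ⊆ D → IsVagueLDP μ t (rateOne μ t) ∧
        (∀ x ∈ {x | -lamUpper μ t 0 < rateOne μ t x}, rateOne μ t x = absLegendre μ t S x) ∧
        (∀ x ∈ D ∩ {x | -lamUpper μ t 0 < rateOne μ t x}, rateOne μ t x = logMGFStar μ t G x) ∧
        ((0 : ℝ) ∈ G → IsNarrowLDP μ t (rateOne μ t) ∧ rateOne μ t = absLegendre μ t S ∧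
          ∀ x ∈ D', rateOne μ t x = logMGFStar μ t G x) := by
    intro D D' hmax hD hD'
    have hle : ∀ x, rateOne μ t x ≤ rateZero μ t x := fun x =>
      (hmax x).trans (max_le (hc0 x) (hA0 x))
    refine ⟨hvague hle, fun x hx => ?_, fun x hx => (heqL x (hD x hx.1 hx.2)).1,
      fun h0 => ⟨hnarrow h0 hle, funext fun x => ?_, fun x hx => ?_⟩⟩
    · exact ((le_max_iff.1 (hmax x)).resolve_left (not_le.2 hx)).antisymm (hA1 x)
    · exact ((hmax x).trans (max_le ((hcL h0 x).trans (hLA x)) le_rfl)).antisymm (hA1 x)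
    · exact (heqL x (hzero h0 x (hD x (hD' hx)))).1
  have hconclude_dom : ∀ D D' : Set ℝ,
      (∀ x, rateOne μ t x ≤ max ⊥ (absLegendre μ t S x)) →
      (∀ x ∈ D, rateOne μ t x ≤ logMGFStar μ t G x) →
      D' ⊆ D → IsVagueLDP μ t (rateOne μ t) ∧ rateOne μ t = absLegendre μ t S ∧
        (∀ x ∈ D', rateOne μ t x = logMGFStar μ t G x) ∧
        ((0 : ℝ) ∈ G → IsNarrowLDP μ t (rateOne μ t)) := by
    intro D D' hmax hD hD'
    have hleA : ∀ x, rateOne μ t x ≤ absLegendre μ t S x := fun x =>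
      (hmax x).trans (max_le bot_le le_rfl)
    have hle : ∀ x, rateOne μ t x ≤ rateZero μ t x := fun x => (hleA x).trans (hA0 x)
    exact ⟨hvague hle, funext fun x => (hleA x).antisymm (hA1 x),
      fun x hx => (heqL x (hD x (hD' hx))).1, fun h0 => hnarrow h0 hle⟩
  refine ⟨fun h => ?_, fun h => ?_, fun h => ?_, fun h => ?_,
    fun hconv => ⟨fun h => ?_, fun h => ?_⟩, fun hconv _ => ⟨fun h => ?_, fun h => ?_⟩⟩
  · have hle : ∀ x, rateOne μ t x ≤ rateZero μ t x := fun x =>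
      (hDomTop _ _ (hbound _ _ hL0 h) x).trans (max_le (hc0 x) le_rfl)
    refine ⟨rateOne μ t, hvague hle, fun x hx => heqL x (hR x (h ⟨hDom01 hx.1, hx.2⟩)),
      fun h0 => ⟨hnarrow h0 hle, fun x hx => heqL x (hzero h0 x fun hlt => ?_)⟩⟩
    exact hR x (h ⟨hDom01 hx, hlt⟩)
  · have hle : ∀ x, rateOne μ t x ≤ rateZero μ t x := fun x =>
      (hDomTop _ _ (hbound' _ _ hL0 h) x).trans (max_le bot_le le_rfl)
    exact ⟨rateOne μ t, hvague hle, fun x hx => heqL x (hR x (h (hDom01 hx))),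
      fun h0 => hnarrow h0 hle⟩
  · have hmax := hDomTop _ _ (hbound _ _ hLA h)
    exact ⟨rateOne μ t, hconclude _ _ hmax (fun x hx hlt => hR x (h ⟨hx, hlt⟩)) hDomA1⟩
  · have hmax := hDomTop _ _ (hbound' _ _ hLA h)
    exact ⟨rateOne μ t, hconclude_dom _ _ hmax (fun x hx => hR x (h hx)) hDomA1⟩
  · have hle : ∀ x, rateOne μ t x ≤ rateZero μ t x := fun x =>
      (hextend _ _ hconv hL0 (fun _ => le_rfl) (hbound _ _ hL0 h) x).trans (max_le (hc0 x) le_rfl)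
    refine ⟨rateOne μ t, hvague hle,
      fun x hx => heqL x (hR x (h ⟨interior_mono hDom01 hx.1, hx.2⟩)),
      fun h0 => ⟨hnarrow h0 hle, fun x hx => heqL x (hzero h0 x fun hlt => ?_)⟩⟩
    exact hR x (h ⟨interior_mono hDom01 hx, hlt⟩)
  · have hle : ∀ x, rateOne μ t x ≤ rateZero μ t x := fun x =>
      (hextend _ _ hconv hL0 (fun _ => le_rfl) (hbound' _ _ hL0 h) x).trans (max_le bot_le le_rfl)
    exact ⟨rateOne μ t, hvague hle, fun x hx => heqL x (hR x (h (interior_mono hDom01 hx))),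
      fun h0 => hnarrow h0 hle⟩
  · have hmax := hextend _ _ hconv hLA hA0 (hbound _ _ hLA h)
    exact ⟨rateOne μ t, hconclude _ _ hmax (fun x hx hlt => hR x (h ⟨hx, hlt⟩))
      (interior_mono hDomA1)⟩
  · have hmax := hextend _ _ hconv hLA hA0 (hbound' _ _ hLA h)
    exact ⟨rateOne μ t, hconclude_dom _ _ hmax (fun x hx => hR x (h hx)) (interior_mono hDomA1)⟩
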